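/- Let $M$ be a smooth finite-dimensional manifold without boundary. A \emph{discretization map} on $M$ is a smooth map $R=(R^1,R^2)\colon U\to M\times M$, defined on an open neighbourhood $U\subset TM$ of the zero section, such that for every $x\in M$: (1) $R(0_x)=(x,x)$; (2) $T_{0_x}R^2_x-T_{0_x}R^1_x=\mathrm{Id}_{T_xM}$, where $R^a_x$ is the restriction of $R^a$ to $U\cap T_xM$ and $T_{0_x}T_xM\simeq T_xM$. Let $Q$ be a smooth finite-dimensional manifold without boundary and let $R_d\colon U\subset TQ\to Q\times Q$ be a discretization map on $Q$. Let - $\alpha_Q\colon TT^*Q\to T^*TQ$ be the canonical isomorphism, given in the coordinates induced by a chart of $Q$ by $(q,p,\dot q,\dot p)\mapsto(q,\dot q,\dot p,p)$, i.e. the covector $(\delta q,\delta v)\mapsto \dot p(\delta q)+p(\delta v)$ at $(q,\dot q)\in TQ$; - $\widehat{R_d}$ be the map with values in $T^*(Q\times Q)$ that sends a covector $\beta\in T^*_{\xi}TQ$ to $\beta\circ(T_{\xi}R_d)^{-1}\in T^*_{R_d(\xi)}(Q\times Q)$, defined for all $\xi\in U$ at which $T_\xi R_d$ is invertible; - $\Phi\colon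 T^*Q\times T^*Q\to T^*(Q\times Q)$ be the bijection $(q_0,p_0;q_1,p_1)\mapsto(q_0,q_1,-p_0,p_1)$. Then the cotangent lift $R_d^{T^*}=\Phi^{-1}\circ\widehat{R_d}\circ\alpha_Q$, defined on the set of all $X\in TT^*Q$ such that $\alpha_Q(X)$ is a covector at a point $\xi\in U$ with $T_\xi R_d$ invertible, is a discretization map on $T^*Q$. That is, this set is an open neighbourhood of the zero section of $TT^*Q$, $R_d^{T^*}$ is smooth on it, $R_d^{T^*}(0_{(q,p)})=((q,p),(q,p))$ for every $(q,p)\in T^*Q$, and the difference $T_{0}\big(R_d^{T^*}\big)^2_{(q,p)}-T_{0}\big(R_d^{T^*}\big)^1_{(q,p)}$ of the derivatives at zero of the restrictions of the two components to the fibre $T_{(q,p)}T^*Q$ is the identity of $T_{(q,p)}T^*Q$. -/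

import Mathlib

open Bundle
open scoped Manifold ContDiff

noncomputable section

namespace DiscretizationMap

universe u v w

variable {E : Type u} [NormedAddCommGroup E] [NormedSpace ℝ E]
  {H : Type v} [TopologicalSpace H] (I : ModelWithCorners ℝ E H)
  {M : Type w} [TopologicalSpace M] [ChartedSpace H M]

/-- The derivative `T_{0ₓ}fₓ : T_{0ₓ}TₓM ≃ TₓM → T_{f(0ₓ)}M` at zero of the restriction `fₓ` of
`f : TM → M` to the fibre `TₓM`. In Mathlib, `T_yM` is the model space `E` for each `y`, a tangent
vector being represented by its coordinates in the preferred chart at `y`. -/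
def fiberDeriv (f : TangentBundle I M → M) (x : M) : E →L[ℝ] E :=
  mfderiv 𝓘(ℝ, E) I (fun u : E => f (⟨x, u⟩ : TangentBundle I M)) 0

/-- A map `R = (R¹, R²) : U ⊆ TM → M × M` is a (smooth) discretization map on `M`:
`U` is an open neighbourhood of the zero section, `R` is smooth on `U`, `R(0ₓ) = (x, x)`, and the
difference of the derivatives at `0ₓ` of the restrictions `R²ₓ, R¹ₓ` to the fibre `TₓM` is the
identity of `TₓM`. Outside `U` the values of `R` are irrelevant. -/
structure IsDiscretizationMap [IsManifold I 1 M]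
    (U : Set (TangentBundle I M)) (R : TangentBundle I M → M × M) : Prop where
  isOpen_domain : IsOpen U
  zero_mem : ∀ x : M, (⟨x, 0⟩ : TangentBundle I M) ∈ U
  contMDiffOn : ContMDiffOn I.tangent (I.prod I) ∞ R U
  map_zero : ∀ x : M, R ⟨x, 0⟩ = (x, x)
  /-- Both derivatives take their values in `TₓM`, because `Rᵃ(0ₓ) = x` by `map_zero`. -/
  fiberDeriv_sub : ∀ x : M,
    fiberDeriv I (fun ξ => (R ξ).2) x - fiberDeriv I (fun ξ => (R ξ).1) x =
      ContinuousLinearMap.id ℝ E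

/-- The cotangent space `T*ₓM`. -/
abbrev CotangentSpace (x : M) : Type u := TangentSpace I x →L[ℝ] Bundle.Trivial M ℝ x

variable (M) in
/-- The cotangent bundle `T*M`, the bundle of continuous linear maps from `TM` to the trivial
line bundle, with the vector bundle and manifold structure that Mathlib gives to such a bundle. -/
abbrev CotangentBundle : Type (max w u) :=
  TotalSpace (E →L[ℝ] ℝ) (CotangentSpace I : M → Type u)

variable (E) in
/-- The model with corners of the manifold `T*M`. -/
abbrev cotangentModel : ModelWithCorners ℝ (E × (E →L[ℝ] ℝ)) (ModelProd H (E →L[ℝ] ℝ)) :=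
  I.prod 𝓘(ℝ, E →L[ℝ] ℝ)

/-- `F̂ = T*(F⁻¹) : T*M₁ → T*M₂`, sending `α ∈ T*ₓM₁` to the covector `α ∘ (TₓF)⁻¹` at `F x`. It is
only meaningful at points `x` where `F` is a local diffeomorphism, i.e. `TₓF` is invertible. -/
def hat {E' : Type*} [NormedAddCommGroup E'] [NormedSpace ℝ E']
    {H' : Type*} [TopologicalSpace H'] (I' : ModelWithCorners ℝ E' H')
    {M' : Type*} [TopologicalSpace M'] [ChartedSpace H' M'] (F : M → M')
    (a : CotangentBundle I M) : CotangentBundle I' M' :=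
  ⟨F a.proj, a.snd ∘L (mfderiv I I' F a.proj).inverse⟩

/-- `Φ : T*M × T*M → T*(M × M)`, `(q₀, p₀; q₁, p₁) ↦ (q₀, q₁, -p₀, p₁)`. -/
def Phi : CotangentBundle I M × CotangentBundle I M ≃ CotangentBundle (I.prod I) (M × M) where
  toFun a := ⟨(a.1.proj, a.2.proj),
    ContinuousLinearMap.coprod (M₁ := E) (M₂ := E) (-a.1.snd : E →L[ℝ] ℝ) (a.2.snd : E →L[ℝ] ℝ)⟩
  invFun b := (⟨b.proj.1, -((b.snd : E × E →L[ℝ] ℝ) ∘L ContinuousLinearMap.inl ℝ E E)⟩,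
    ⟨b.proj.2, (b.snd : E × E →L[ℝ] ℝ) ∘L ContinuousLinearMap.inr ℝ E E⟩)
  left_inv a := by
    have h₁ : ∀ p r : E →L[ℝ] ℝ,
        -(ContinuousLinearMap.coprod (-p) r ∘L ContinuousLinearMap.inl ℝ E E) = p := by
      intro p r; ext u; simp
    have h₂ : ∀ p r : E →L[ℝ] ℝ,
        ContinuousLinearMap.coprod (-p) r ∘L ContinuousLinearMap.inr ℝ E E = r := by
      intro p r; ext u; simp
    exact Prod.ext (congrArg (TotalSpace.mk a.1.proj) (h₁ a.1.snd a.2.snd))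
      (congrArg (TotalSpace.mk a.2.proj) (h₂ a.1.snd a.2.snd))
  right_inv b := by
    have h : ∀ s : E × E →L[ℝ] ℝ,
        ContinuousLinearMap.coprod (- -(s ∘L ContinuousLinearMap.inl ℝ E E))
          (s ∘L ContinuousLinearMap.inr ℝ E E) = s := by
      intro s; ext u <;> simp
    exact congrArg (TotalSpace.mk b.proj) (h b.snd)

variable [IsManifold I ∞ M]

/-- The Tulczyjew isomorphism `α_M : TT*M → T*TM`, `(q, p, q̇, ṗ) ↦ (q, q̇, ṗ, p)`: the value is the
covector `(δq, δv) ↦ ṗ(δq) + p(δv)` at `(q, q̇) ∈ TM`. The coordinates are those induced by the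
preferred chart of `M` at `q`: in Mathlib the preferred charts of `T*M` at `(q, p)` and of `TM` at
`(q, q̇)` are the ones induced by it, and a tangent vector at these points is represented by its
coordinates in them. -/
def alpha (X : TangentBundle (cotangentModel E I) (CotangentBundle I M)) :
    CotangentBundle I.tangent (TangentBundle I M) :=
  ⟨⟨X.proj.proj, (X.snd : E × (E →L[ℝ] ℝ)).1⟩,
    ContinuousLinearMap.coprod (M₁ := E) (M₂ := E)
      (X.snd : E × (E →L[ℝ] ℝ)).2 (X.proj.snd : E →L[ℝ] ℝ)⟩

/-- The cotangent lift `Φ⁻¹ ∘ R̂ ∘ α_M : TT*M → T*M × T*M` of `R : TM → M × M`. -/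
def cotangentLift (R : TangentBundle I M → M × M) :
    TangentBundle (cotangentModel E I) (CotangentBundle I M) →
      CotangentBundle I M × CotangentBundle I M :=
  (Phi I).symm ∘ hat I.tangent (I.prod I) R ∘ alpha I

/-- The domain of the cotangent lift of `R : U ⊆ TM → M × M`: all `X ∈ TT*M` such that `α_M X` is a
covector at a point of `U` at which `R` is a local diffeomorphism, i.e. has invertible
derivative. -/
def cotangentLiftDomain (U : Set (TangentBundle I M)) (R : TangentBundle I M → M × M) :
    Set (TangentBundle (cotangentModel E I) (CotangentBundle I M)) :=
  {X | (alpha I X).proj ∈ U ∧ (mfderiv I.tangent (I.prod I) R (alpha I X).proj).IsInvertible}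

end DiscretizationMap

end

/-! In the chart of `Q` at a point `q`, with coordinate `x`, the map `R` becomes a map `F` of `E ×
E` such that F(y, 0) = (y, y) and D(F² - F¹)(y, 0)(0, v) = v for all y near x. Differentiating the
first identity, L = DF(x, 0) satisfies L(a, 0) = (a, a). With the second identity this makes L
invertible, with L⁻¹(a, a) = (a, 0) and L⁻¹(z₁, z₂) having second component z₂ - z₁. Hence the lift
is defined at all zero vectors.

In these coordinates the lift sends (x, p, v, r) to (F¹, -m ∘ inl) and (F², m ∘ inr), where m = (r,
p) ∘ DF(x, v)⁻¹. For v = 0 and r = 0 one gets m(z) = p(z₂ - z₁), so both momenta equal p. In the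
difference of the fibre derivatives, the position part is the hypothesis on `R`. The difference of
the momenta, evaluated at a, is m(a, a); its derivative in the direction (v, r) is r(a) - p(c),
where c is the difference of the two components of D²F(x, 0)((0, v), (a, 0)). By symmetry, c is the
derivative in the direction a, along the zero section, of the constant D(F² - F¹)(y, 0)(0, v) = v,
so c = 0. This is `fderiv_momentum_diag`.

The rest is chart bookkeeping. The lift is defined through the preferred charts at each point, and
these vary discontinuously, so each factor needs its formula in one fixed chart:
`covectorCoord_alpha`, `covectorCoord_hat`, `covectorCoord_Phi_symm_fst` and
`covectorCoord_Phi_symm_snd`. For `alpha` this rests on the invariance of ṗ(δq) + p(δv) under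
transition maps (`pairing_transition`), again by symmetry of second derivatives. Smoothness and
openness come from operator inversion on a complete space. -/

noncomputable section

namespace DiscretizationMap

open Set Filter Topology

/-! ### Covectors and derivatives in a fixed chart. -/

section Basics

variable {E : Type*} [NormedAddCommGroup E] [NormedSpace ℝ E]
  {H : Type*} [TopologicalSpace H] {I : ModelWithCorners ℝ E H}
  {M : Type*} [TopologicalSpace M] [ChartedSpace H M] [IsManifold I 1 M]
  {E' : Type*} [NormedAddCommGroup E'] [NormedSpace ℝ E']
  {H' : Type*} [TopologicalSpace H'] {I' : ModelWithCorners ℝ E' H'}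
  {M' : Type*} [TopologicalSpace M'] [ChartedSpace H' M'] [IsManifold I' 1 M']

theorem tangentCoordChange_comp_symm {x y z : M} (hx : z ∈ (extChartAt I x).source)
    (hy : z ∈ (extChartAt I y).source) :
    tangentCoordChange I x y z ∘L tangentCoordChange I y x z = ContinuousLinearMap.id ℝ E := by
  ext v
  exact (tangentCoordChange_comp (I := I) ⟨⟨hy, hx⟩, hy⟩).trans (tangentCoordChange_self hy)

theorem isInvertible_tangentCoordChange {x y z : M} (hx : z ∈ (extChartAt I x).source)
    (hy : z ∈ (extChartAt I y).source) : (tangentCoordChange I x y z).IsInvertible :=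
  .of_inverse (tangentCoordChange_comp_symm hx hy) (tangentCoordChange_comp_symm hy hx)

theorem inverse_tangentCoordChange {x y z : M} (hx : z ∈ (extChartAt I x).source)
    (hy : z ∈ (extChartAt I y).source) :
    (tangentCoordChange I x y z).inverse = tangentCoordChange I y x z :=
  ContinuousLinearMap.inverse_eq (tangentCoordChange_comp_symm hx hy)
    (tangentCoordChange_comp_symm hy hx)

theorem tangentCoordChange_self_eq_id {x z : M} (h : z ∈ (extChartAt I x).source) :
    tangentCoordChange I x x z = ContinuousLinearMap.id ℝ E :=
  ContinuousLinearMap.ext fun _ => tangentCoordChange_self h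

/-- The components of a covector in the chart of `M` at `x₀`. -/
def covectorCoord (I : ModelWithCorners ℝ E H) [IsManifold I 1 M] (x₀ : M)
    (b : CotangentBundle I M) : E →L[ℝ] ℝ :=
  (b.snd : E →L[ℝ] ℝ) ∘L tangentCoordChange I x₀ b.proj b.proj

theorem covectorCoord_self (b : CotangentBundle I M) : covectorCoord I b.proj b = b.snd := by
  rw [covectorCoord, tangentCoordChange_self_eq_id (mem_extChartAt_source _)]
  rfl

theorem trivializationAt_cotangentBundle_snd {x₀ : M} {b : CotangentBundle I M}
    (hb : b.proj ∈ (extChartAt I x₀).source) :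
    (trivializationAt (E →L[ℝ] ℝ) (CotangentSpace I : M → Type _) x₀ b).2 =
      covectorCoord I x₀ b := by
  rw [hom_trivializationAt_apply]
  rw [extChartAt_source] at hb
  simp only [ContinuousLinearMap.inCoordinates]
  rw [TangentBundle.symmL_trivializationAt_eq_core hb]
  ext v
  simp [covectorCoord]

omit [IsManifold I' 1 M'] in
-- Smoothness into the cotangent bundle is tested with the chart frozen at the image of `x`; every
-- smoothness proof below for a map into a cotangent bundle goes through this criterion.
theorem contMDiffAt_cotangentBundle_iff {n : WithTop ℕ∞} {f : M' → CotangentBundle I M} {x : M'} :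
    ContMDiffAt I' (cotangentModel E I) n f x ↔
      ContMDiffAt I' I n (fun y => (f y).proj) x ∧
      ContMDiffAt I' 𝓘(ℝ, E →L[ℝ] ℝ) n (fun y => covectorCoord I (f x).proj (f y)) x := by
  rw [contMDiffAt_totalSpace]
  refine and_congr_right fun h => ?_
  have hs : ∀ᶠ y in 𝓝 x, (f y).proj ∈ (extChartAt I (f x).proj).source :=
    h.continuousAt (extChartAt_source_mem_nhds _)
  exact EventuallyEq.contMDiffAt_iff
    (hs.mono fun y hy => trivializationAt_cotangentBundle_snd hy)

theorem extChartAt_cotangentBundle_apply {a b : CotangentBundle I M}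
    (hb : b.proj ∈ (extChartAt I a.proj).source) :
    extChartAt (cotangentModel E I) a b =
      (extChartAt I a.proj b.proj, covectorCoord I a.proj b) := by
  rw [FiberBundle.extChartAt, ← trivializationAt_cotangentBundle_snd hb]
  simp only [PartialEquiv.trans_apply, PartialEquiv.prod_coe, PartialEquiv.refl_coe]
  have h : b.proj ∈ (trivializationAt (E →L[ℝ] ℝ) (CotangentSpace I : M → Type _) a.proj).baseSet :=
    by simpa [hom_trivializationAt_baseSet] using hb
  exact Prod.ext (congrArg (extChartAt I a.proj) (Trivialization.coe_fst' _ h)) rfl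

theorem extChartAt_tangentBundle_apply (a b : TangentBundle I M) :
    extChartAt I.tangent a b =
      (extChartAt I a.proj b.proj, tangentCoordChange I b.proj a.proj b.proj b.snd) := by
  rw [FiberBundle.extChartAt]
  rfl

theorem mem_extChartAt_tangentBundle_source {a b : TangentBundle I M} :
    b ∈ (extChartAt I.tangent a).source ↔ b.proj ∈ (extChartAt I a.proj).source := by
  rw [extChartAt_source, extChartAt_source]
  exact TangentBundle.mem_chart_source_iff b a

theorem mem_extChartAt_cotangentBundle_source {a b : CotangentBundle I M} :
    b ∈ (extChartAt (cotangentModel E I) a).source ↔ b.proj ∈ (extChartAt I a.proj).source := by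
  rw [extChartAt_source, extChartAt_source, FiberBundle.chartedSpace_chartAt]
  simp +contextual

variable [I.Boundaryless] [I'.Boundaryless]

theorem tangentCoordChange_eq_fderiv (x y z : M) :
    tangentCoordChange I x y z =
      fderiv ℝ (extChartAt I y ∘ (extChartAt I x).symm) (extChartAt I x z) := by
  rw [tangentCoordChange_def, I.range_eq_univ, fderivWithin_univ]

/-- The derivative of `F` at `x` as a linear map between the model spaces, i.e. in the preferred
charts at `x` and `F x`. -/
def modelDeriv (I : ModelWithCorners ℝ E H) (I' : ModelWithCorners ℝ E' H') (F : M → M') (x : M) :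
    E →L[ℝ] E' :=
  mfderiv I I' F x

/-- `mfderiv` is the derivative in the preferred charts at `x` and `F x`; the chain rule with a
coordinate change on each side moves it to charts that stay fixed while `x` varies. -/
theorem hasFDerivAt_chart_comp {F : M → M'} {x₀ x : M} {y₀ : M'}
    (hF : MDifferentiableAt I I' F x) (hx : x ∈ (extChartAt I x₀).source)
    (hy : F x ∈ (extChartAt I' y₀).source) :
    HasFDerivAt (extChartAt I' y₀ ∘ F ∘ (extChartAt I x₀).symm)
      (tangentCoordChange I' (F x) y₀ (F x) ∘L modelDeriv I I' F x ∘L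
        tangentCoordChange I x₀ x x) (extChartAt I x₀ x) := by
  have h1 : HasFDerivAt (extChartAt I x ∘ (extChartAt I x₀).symm)
      (tangentCoordChange I x₀ x x) (extChartAt I x₀ x) := by
    have := hasFDerivWithinAt_tangentCoordChange (I := I) ⟨hx, mem_extChartAt_source (I := I) x⟩
    rwa [I.range_eq_univ, hasFDerivWithinAt_univ] at this
  have h3 : HasFDerivAt (extChartAt I' y₀ ∘ (extChartAt I' (F x)).symm)
      (tangentCoordChange I' (F x) y₀ (F x)) (extChartAt I' (F x) (F x)) := by
    have := hasFDerivWithinAt_tangentCoordChange (I := I')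
      ⟨mem_extChartAt_source (I := I') (F x), hy⟩
    rwa [I'.range_eq_univ, hasFDerivWithinAt_univ] at this
  have h2 : HasFDerivAt (extChartAt I' (F x) ∘ F ∘ (extChartAt I x).symm)
      (modelDeriv I I' F x) (extChartAt I x x) := by
    have : HasFDerivWithinAt (extChartAt I' (F x) ∘ F ∘ (extChartAt I x).symm)
      (modelDeriv I I' F x) (range I) (extChartAt I x x) := hF.hasMFDerivAt.2
    rwa [I.range_eq_univ, hasFDerivWithinAt_univ] at this
  have e1 : (extChartAt I x ∘ (extChartAt I x₀).symm) (extChartAt I x₀ x) = extChartAt I x x := by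
    rw [Function.comp_apply, (extChartAt I x₀).left_inv hx]
  have e2 : (extChartAt I' (F x) ∘ F ∘ (extChartAt I x).symm) (extChartAt I x x) =
      extChartAt I' (F x) (F x) := by
    simp
  have h12 := HasFDerivAt.comp (extChartAt I x₀ x) (e1 ▸ h2) h1
  have h := HasFDerivAt.comp (extChartAt I x₀ x)
    (show HasFDerivAt (extChartAt I' y₀ ∘ (extChartAt I' (F x)).symm)
      (tangentCoordChange I' (F x) y₀ (F x)) _ by
        rw [Function.comp_apply, e1, e2]; exact h3) h12
  refine h.congr_of_eventuallyEq ?_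
  have c0 : ContinuousAt (extChartAt I x₀).symm (extChartAt I x₀ x) :=
    continuousAt_extChartAt_symm' hx
  have s1 : ∀ᶠ e in 𝓝 (extChartAt I x₀ x), (extChartAt I x₀).symm e ∈ (extChartAt I x).source :=
    c0 (by rw [(extChartAt I x₀).left_inv hx]; exact extChartAt_source_mem_nhds _)
  have s2 : ∀ᶠ e in 𝓝 (extChartAt I x₀ x),
      F ((extChartAt I x₀).symm e) ∈ (extChartAt I' (F x)).source := by
    refine (ContinuousAt.comp (g := F) ?_ c0) ?_
    · rw [(extChartAt I x₀).left_inv hx]; exact hF.continuousAt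
    · rw [Function.comp_apply, (extChartAt I x₀).left_inv hx]; exact extChartAt_source_mem_nhds _
  filter_upwards [s1, s2] with e he1 he2
  simp only [Function.comp_apply]
  rw [(extChartAt I x).left_inv he1, (extChartAt I' (F x)).left_inv he2]

omit [IsManifold I 1 M] [IsManifold I' 1 M'] [I'.Boundaryless] in
theorem contDiffAt_chart_comp {n : WithTop ℕ∞} [IsManifold I n M] [IsManifold I' n M']
    {F : M → M'} {x₀ x : M} {y₀ : M'}
    (hF : ContMDiffAt I I' n F x) (hx : x ∈ (extChartAt I x₀).source)
    (hy : F x ∈ (extChartAt I' y₀).source) :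
    ContDiffAt ℝ n (extChartAt I' y₀ ∘ F ∘ (extChartAt I x₀).symm) (extChartAt I x₀ x) := by
  rw [extChartAt_source] at hx hy
  have := (contMDiffAt_iff_of_mem_source hx hy).1 hF
  have h := this.2
  rwa [I.range_eq_univ, contDiffWithinAt_univ] at h

/-- The cotangent lift of a map in the charts at `x₀` and `y₀`. -/
theorem covectorCoord_hat {F : M → M'} {x₀ : M} {y₀ : M'} {b : CotangentBundle I M}
    (hF : MDifferentiableAt I I' F b.proj) (hx : b.proj ∈ (extChartAt I x₀).source)
    (hy : F b.proj ∈ (extChartAt I' y₀).source) :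
    covectorCoord I' y₀ (hat I I' F b) = covectorCoord I x₀ b ∘L
      (fderiv ℝ (extChartAt I' y₀ ∘ F ∘ (extChartAt I x₀).symm)
        (extChartAt I x₀ b.proj)).inverse := by
  rw [(hasFDerivAt_chart_comp hF hx hy).fderiv]
  rw [(isInvertible_tangentCoordChange (mem_extChartAt_source _) hy).inverse_comp_of_left,
    ContinuousLinearMap.IsInvertible.inverse_comp_of_right
      (isInvertible_tangentCoordChange hx (mem_extChartAt_source _)),
    inverse_tangentCoordChange (mem_extChartAt_source _) hy,
    inverse_tangentCoordChange hx (mem_extChartAt_source _)]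
  -- The coordinate changes at the source, one from the covector and one from the inverse
  -- derivative, cancel.
  have hid := tangentCoordChange_comp_symm hx (mem_extChartAt_source (I := I) b.proj)
  ext v
  have hv : ∀ w : E, tangentCoordChange I x₀ b.proj b.proj
      (tangentCoordChange I b.proj x₀ b.proj w) = w := fun w => DFunLike.congr_fun hid w
  change (b.snd : E →L[ℝ] ℝ) _ = (b.snd : E →L[ℝ] ℝ) (tangentCoordChange I x₀ b.proj b.proj
      (tangentCoordChange I b.proj x₀ b.proj _))
  rw [hv]
  rfl

end Basics

/-! ### Tangent and cotangent lifts of a transition map. -/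

section Euclidean

variable {E : Type*} [NormedAddCommGroup E] [NormedSpace ℝ E]

/-- The map `(x, v) ↦ (φ x, Dφ(x) v)`. -/
def tangentTransition (φ : E → E) (z : E × E) : E × E := (φ z.1, fderiv ℝ φ z.1 z.2)

/-- The map `(x, p) ↦ (φ x, p ∘ Dφ(x)⁻¹)`. -/
def cotangentTransition (φ : E → E) (z : E × (E →L[ℝ] ℝ)) : E × (E →L[ℝ] ℝ) :=
  (φ z.1, z.2 ∘L (fderiv ℝ φ z.1).inverse)

variable {φ : E → E} {x : E}

theorem fderiv_tangentTransition (hφ : ContDiffAt ℝ 2 φ x) (v : E) (d : E × E) :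
    fderiv ℝ (tangentTransition φ) (x, v) d =
      (fderiv ℝ φ x d.1, fderiv ℝ (fderiv ℝ φ) x d.1 v + fderiv ℝ φ x d.2) := by
  have h1 : HasFDerivAt φ (fderiv ℝ φ x) x := (hφ.differentiableAt (by simp)).hasFDerivAt
  have h2 : HasFDerivAt (fderiv ℝ φ) (fderiv ℝ (fderiv ℝ φ) x) x :=
    ((hφ.fderiv_right (m := 1) (by norm_num)).differentiableAt (by simp)).hasFDerivAt
  have hfst : HasFDerivAt (Prod.fst : E × E → E) (ContinuousLinearMap.fst ℝ E E) (x, v) :=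
    hasFDerivAt_fst
  have h := (HasFDerivAt.comp (x, v) (g := φ) h1 hfst).prodMk
    ((HasFDerivAt.comp (x, v) (g := fderiv ℝ φ) h2 hfst).clm_apply hasFDerivAt_snd)
  have h' : HasFDerivAt (tangentTransition φ) _ (x, v) := h
  rw [h'.fderiv]
  simp [add_comm]

theorem fderiv_cotangentTransition [CompleteSpace E] (hφ : ContDiffAt ℝ 2 φ x)
    (hi : (fderiv ℝ φ x).IsInvertible) (p : E →L[ℝ] ℝ) (w : E × (E →L[ℝ] ℝ)) :
    fderiv ℝ (cotangentTransition φ) (x, p) w =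
      (fderiv ℝ φ x w.1, p ∘L fderiv ℝ (fun y => (fderiv ℝ φ y).inverse) x w.1 +
        w.2 ∘L (fderiv ℝ φ x).inverse) := by
  have h1 : HasFDerivAt φ (fderiv ℝ φ x) x := (hφ.differentiableAt (by simp)).hasFDerivAt
  have h2 : HasFDerivAt (fun y => (fderiv ℝ φ y).inverse)
      (fderiv ℝ (fun y => (fderiv ℝ φ y).inverse) x) x :=
    ((hi.contDiffAt_map_inverse.comp x (hφ.fderiv_right (m := 1) (by norm_num))).differentiableAt
      (by simp)).hasFDerivAt
  have hfst : HasFDerivAt (Prod.fst : E × (E →L[ℝ] ℝ) → E)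
    (ContinuousLinearMap.fst ℝ E (E →L[ℝ] ℝ)) (x, p) := hasFDerivAt_fst
  have h := (HasFDerivAt.comp (x, p) (g := φ) h1 hfst).prodMk
    (HasFDerivAt.clm_comp (c := fun z : E × (E →L[ℝ] ℝ) => z.2) hasFDerivAt_snd
      (HasFDerivAt.comp (x, p) (g := fun y => (fderiv ℝ φ y).inverse) h2 hfst))
  have h' : HasFDerivAt (cotangentTransition φ) _ (x, p) := h
  rw [h'.fderiv]
  simp

theorem eventually_isInvertible {X V W : Type*} [TopologicalSpace X]
    [NormedAddCommGroup V] [NormedSpace ℝ V] [CompleteSpace V] [NormedAddCommGroup W]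
    [NormedSpace ℝ W] {L : X → V →L[ℝ] W} {x : X} (hL : ContinuousAt L x)
    (hi : (L x).IsInvertible) : ∀ᶠ y in 𝓝 x, (L y).IsInvertible := by
  obtain ⟨e, he⟩ := hi
  exact hL (he ▸ ContinuousLinearEquiv.nhds e)

/-- The derivative of the inverse of a family of invertible linear maps. -/
theorem fderiv_inverse_comp {V W : Type*} [NormedAddCommGroup V] [NormedSpace ℝ V]
    [CompleteSpace V] [NormedAddCommGroup W] [NormedSpace ℝ W] {L : E → V →L[ℝ] W}
    (hL : ContDiffAt ℝ 1 L x) (hi : (L x).IsInvertible) (w : E) (u : V) :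
    fderiv ℝ (fun y => (L y).inverse) x w (L x u) = - (L x).inverse (fderiv ℝ L x w u) := by
  have h2 : HasFDerivAt L (fderiv ℝ L x) x := (hL.differentiableAt (by simp)).hasFDerivAt
  have h3 : HasFDerivAt (fun y => (L y).inverse) (fderiv ℝ (fun y => (L y).inverse) x) x :=
    ((hi.contDiffAt_map_inverse.comp x hL).differentiableAt (by simp)).hasFDerivAt
  -- Near `x` the product of `(L y).inverse` and `L y` is constantly the identity, so the product
  -- rule gives zero.
  have hk := ((h3.clm_comp h2).congr_of_eventuallyEq (f₁ := fun _ => ContinuousLinearMap.id ℝ V)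
    ((eventually_isInvertible hL.continuousAt hi).mono
      fun y hy => hy.inverse_comp_self.symm)).unique (hasFDerivAt_const _ _)
  have := DFunLike.congr_fun (DFunLike.congr_fun hk w) u
  simp at this
  exact eq_neg_of_add_eq_zero_right this

/-- The pairing `(w, d) ↦ ṗ(δq) + p(δv)` is invariant under a change of coordinates `φ`. -/
theorem pairing_transition [CompleteSpace E] (hφ : ContDiffAt ℝ 2 φ x)
    (hi : (fderiv ℝ φ x).IsInvertible) (p : E →L[ℝ] ℝ) (w : E × (E →L[ℝ] ℝ)) (d : E × E) :
    (fderiv ℝ (cotangentTransition φ) (x, p) w).2 (fderiv ℝ (tangentTransition φ) (x, w.1) d).1 +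
      (p ∘L (fderiv ℝ φ x).inverse) (fderiv ℝ (tangentTransition φ) (x, w.1) d).2 =
      w.2 d.1 + p d.2 := by
  -- The tangent lift contributes D²φ(δq, q̇) and the derivative of the inverse contributes -D²φ(q̇,
  -- δq), both under p ∘ Dφ⁻¹; symmetry cancels them.
  have hs : fderiv ℝ (fderiv ℝ φ) x w.1 d.1 = fderiv ℝ (fderiv ℝ φ) x d.1 w.1 :=
    (hφ.isSymmSndFDerivAt (by simp)).eq _ _
  have hinv : ∀ u, (fderiv ℝ φ x).inverse (fderiv ℝ φ x u) = u := fun u =>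
    DFunLike.congr_fun hi.inverse_comp_self u
  rw [fderiv_tangentTransition hφ, fderiv_cotangentTransition hφ hi]
  simp [fderiv_inverse_comp (hφ.fderiv_right (m := 1) (by norm_num)) hi, hs, hinv]
  ring

end Euclidean

/-! ### Transition maps of the tangent and cotangent bundles. -/

section Transition

variable {E : Type*} [NormedAddCommGroup E] [NormedSpace ℝ E]
  {H : Type*} [TopologicalSpace H] {I : ModelWithCorners ℝ E H} [I.Boundaryless]
  {M : Type*} [TopologicalSpace M] [ChartedSpace H M] [IsManifold I 1 M]

omit [I.Boundaryless] in
theorem covectorCoord_comp_tangentCoordChange {x y : M} {b : CotangentBundle I M}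
    (hx : b.proj ∈ (extChartAt I x).source) (hy : b.proj ∈ (extChartAt I y).source) :
    covectorCoord I x b ∘L tangentCoordChange I y x b.proj = covectorCoord I y b := by
  ext v
  exact congrArg (b.snd : E →L[ℝ] ℝ)
    (tangentCoordChange_comp (I := I) ⟨⟨hy, hx⟩, mem_extChartAt_source _⟩)

/-- Equality on a neighbourhood, not just at a point, lets the derivative of the bundle transition
be computed from `cotangentTransition`. -/
theorem cotangentBundle_transition {a a₀ b : CotangentBundle I M}
    (ha : b.proj ∈ (extChartAt I a.proj).source) (ha₀ : b.proj ∈ (extChartAt I a₀.proj).source) :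
    extChartAt (cotangentModel E I) a₀ ∘ (extChartAt (cotangentModel E I) a).symm
      =ᶠ[𝓝 (extChartAt (cotangentModel E I) a b)]
        cotangentTransition (extChartAt I a₀.proj ∘ (extChartAt I a.proj).symm) := by
  have hb := mem_extChartAt_cotangentBundle_source.2 ha
  have hb₀ := mem_extChartAt_cotangentBundle_source.2 ha₀
  have hc : ∀ᶠ e in 𝓝 (extChartAt (cotangentModel E I) a b),
      (extChartAt (cotangentModel E I) a).symm e ∈ (extChartAt (cotangentModel E I) a₀).source :=
    (continuousAt_extChartAt_symm' hb)
      (by rw [(extChartAt _ a).left_inv hb]; exact extChartAt_source_mem_nhds' hb₀)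
  filter_upwards [hc, extChartAt_target_mem_nhds' ((extChartAt _ a).map_source hb)] with e he₀ he
  obtain ⟨c, hc, rfl⟩ : ∃ c ∈ (extChartAt (cotangentModel E I) a).source,
      extChartAt (cotangentModel E I) a c = e :=
    ⟨_, (extChartAt _ a).map_target he, (extChartAt _ a).right_inv he⟩
  rw [(extChartAt _ a).left_inv hc] at he₀
  rw [mem_extChartAt_cotangentBundle_source] at he₀ hc
  rw [Function.comp_apply, (extChartAt _ a).left_inv (mem_extChartAt_cotangentBundle_source.2 hc),
    extChartAt_cotangentBundle_apply he₀, extChartAt_cotangentBundle_apply hc, cotangentTransition,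
    ← tangentCoordChange_eq_fderiv, inverse_tangentCoordChange hc he₀,
    covectorCoord_comp_tangentCoordChange hc he₀, Function.comp_apply,
    (extChartAt I a.proj).left_inv hc]

theorem tangentBundle_transition {a a₀ b : TangentBundle I M}
    (ha : b.proj ∈ (extChartAt I a.proj).source) (ha₀ : b.proj ∈ (extChartAt I a₀.proj).source) :
    extChartAt I.tangent a₀ ∘ (extChartAt I.tangent a).symm
      =ᶠ[𝓝 (extChartAt I.tangent a b)]
        tangentTransition (extChartAt I a₀.proj ∘ (extChartAt I a.proj).symm) := by
  have hb := mem_extChartAt_tangentBundle_source.2 ha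
  have hb₀ := mem_extChartAt_tangentBundle_source.2 ha₀
  have hc : ∀ᶠ e in 𝓝 (extChartAt I.tangent a b),
      (extChartAt I.tangent a).symm e ∈ (extChartAt I.tangent a₀).source :=
    (continuousAt_extChartAt_symm' hb)
      (by rw [(extChartAt _ a).left_inv hb]; exact extChartAt_source_mem_nhds' hb₀)
  filter_upwards [hc, extChartAt_target_mem_nhds' ((extChartAt _ a).map_source hb)] with e he₀ he
  obtain ⟨c, hc, rfl⟩ : ∃ c ∈ (extChartAt I.tangent a).source,
      extChartAt I.tangent a c = e :=
    ⟨_, (extChartAt _ a).map_target he, (extChartAt _ a).right_inv he⟩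
  rw [(extChartAt _ a).left_inv hc] at he₀
  rw [mem_extChartAt_tangentBundle_source] at he₀ hc
  rw [Function.comp_apply, (extChartAt _ a).left_inv (mem_extChartAt_tangentBundle_source.2 hc),
    extChartAt_tangentBundle_apply, extChartAt_tangentBundle_apply, tangentTransition,
    ← tangentCoordChange_eq_fderiv, Function.comp_apply, (extChartAt I a.proj).left_inv hc]
  exact Prod.ext rfl
    (tangentCoordChange_comp (I := I) ⟨⟨mem_extChartAt_source _, hc⟩, he₀⟩).symm

end Transition

/-! ### The Tulczyjew isomorphism in charts and its smoothness. -/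

section Alpha

variable {E : Type*} [NormedAddCommGroup E] [NormedSpace ℝ E] [CompleteSpace E]
  {H : Type*} [TopologicalSpace H] {I : ModelWithCorners ℝ E H} [I.Boundaryless]
  {M : Type*} [TopologicalSpace M] [ChartedSpace H M] [IsManifold I ∞ M]

/-- The components of a tangent vector in the chart of `M` at `x₀`. -/
def vectorCoord {E : Type*} [NormedAddCommGroup E] [NormedSpace ℝ E]
    {H : Type*} [TopologicalSpace H] (I : ModelWithCorners ℝ E H)
    {M : Type*} [TopologicalSpace M] [ChartedSpace H M] [IsManifold I 1 M] (x₀ : M)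
    (X : TangentBundle I M) : E :=
  tangentCoordChange I X.proj x₀ X.proj X.snd

omit [CompleteSpace E] in
theorem contDiffAt_transition {x₀ x : M} (hx : x ∈ (extChartAt I x₀).source) :
    ContDiffAt ℝ 2 (extChartAt I x₀ ∘ (extChartAt I x).symm) (extChartAt I x x) :=
  (contDiffAt_chart_comp (n := ∞) (F := id) contMDiffAt_id (mem_extChartAt_source x) hx).of_le
    (WithTop.coe_le_coe.2 le_top)

omit [CompleteSpace E] in
theorem vectorCoord_cotangentBundle {a₀ : CotangentBundle I M}
    {X : TangentBundle (cotangentModel E I) (CotangentBundle I M)}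
    (hX : X.proj.proj ∈ (extChartAt I a₀.proj).source) :
    vectorCoord (cotangentModel E I) a₀ X =
      fderiv ℝ (cotangentTransition (extChartAt I a₀.proj ∘ (extChartAt I X.proj.proj).symm))
        (extChartAt I X.proj.proj X.proj.proj, X.proj.snd) X.snd := by
  have h := mem_extChartAt_source (I := I) X.proj.proj
  rw [vectorCoord, tangentCoordChange_eq_fderiv, (cotangentBundle_transition h hX).fderiv_eq,
    extChartAt_cotangentBundle_apply h, covectorCoord_self]

theorem fst_vectorCoord {a₀ : CotangentBundle I M}
    {X : TangentBundle (cotangentModel E I) (CotangentBundle I M)}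
    (hX : X.proj.proj ∈ (extChartAt I a₀.proj).source) :
    (vectorCoord (cotangentModel E I) a₀ X).1 = vectorCoord I a₀.proj (alpha I X).proj := by
  have h := mem_extChartAt_source (I := I) X.proj.proj
  rw [vectorCoord_cotangentBundle hX]
  refine (congrArg Prod.fst (fderiv_cotangentTransition (contDiffAt_transition hX)
    (by rw [← tangentCoordChange_eq_fderiv]; exact isInvertible_tangentCoordChange h hX)
    X.proj.snd X.snd)).trans ?_
  rw [← tangentCoordChange_eq_fderiv]
  rfl

/-- In the charts at `a₀` of `T*M` and at `ξ₀` of `TM`, the map `α_M` is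
`(q, p, q̇, ṗ) ↦ (q, q̇, ṗ, p)`. -/
theorem covectorCoord_alpha {a₀ : CotangentBundle I M} {ξ₀ : TangentBundle I M}
    (h₀ : a₀.proj = ξ₀.proj)
    {X : TangentBundle (cotangentModel E I) (CotangentBundle I M)}
    (hX : X.proj.proj ∈ (extChartAt I a₀.proj).source) :
    covectorCoord I.tangent ξ₀ (alpha I X) =
      ContinuousLinearMap.coprod (vectorCoord (cotangentModel E I) a₀ X).2
        (covectorCoord I a₀.proj X.proj) := by
  have h := mem_extChartAt_source (I := I) X.proj.proj
  have hi : (fderiv ℝ (extChartAt I a₀.proj ∘ (extChartAt I X.proj.proj).symm)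
      (extChartAt I X.proj.proj X.proj.proj)).IsInvertible := by
    rw [← tangentCoordChange_eq_fderiv]; exact isInvertible_tangentCoordChange h hX
  have hξ : (alpha I X).proj ∈ (extChartAt I.tangent (alpha I X).proj).source :=
    mem_extChartAt_source _
  have hξ₀ : (alpha I X).proj ∈ (extChartAt I.tangent ξ₀).source :=
    mem_extChartAt_tangentBundle_source.2 (h₀ ▸ hX)
  have ht : tangentCoordChange I.tangent (alpha I X).proj ξ₀ (alpha I X).proj =
      fderiv ℝ (tangentTransition (extChartAt I a₀.proj ∘ (extChartAt I X.proj.proj).symm))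
        (extChartAt I X.proj.proj X.proj.proj, (X.snd : E × (E →L[ℝ] ℝ)).1) := by
    rw [tangentCoordChange_eq_fderiv, (tangentBundle_transition (mem_extChartAt_source _)
      (h₀ ▸ hX)).fderiv_eq, extChartAt_tangentBundle_apply,
      tangentCoordChange_self_eq_id (mem_extChartAt_source _), h₀]
    rfl
  -- The fixed-chart formula, carried back to the preferred chart at the point, is the defining
  -- formula of `alpha`: this is the invariance of the pairing.
  have key : ContinuousLinearMap.coprod (vectorCoord (cotangentModel E I) a₀ X).2
        (covectorCoord I a₀.proj X.proj) ∘L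
      tangentCoordChange I.tangent (alpha I X).proj ξ₀ (alpha I X).proj =
      (alpha I X).snd := by
    rw [ht, vectorCoord_cotangentBundle hX, covectorCoord, ← inverse_tangentCoordChange h hX,
      tangentCoordChange_eq_fderiv]
    refine ContinuousLinearMap.ext fun d => ?_
    exact pairing_transition (contDiffAt_transition hX) hi X.proj.snd X.snd d
  rw [covectorCoord, ← key]
  refine (ContinuousLinearMap.comp_assoc _ _ _).trans ?_
  exact (congrArg (ContinuousLinearMap.comp _) (tangentCoordChange_comp_symm hξ hξ₀)).trans
    (ContinuousLinearMap.comp_id _)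

omit [CompleteSpace E] [I.Boundaryless] in
theorem contMDiffAt_vectorCoord (X : TangentBundle I M) :
    ContMDiffAt I.tangent 𝓘(ℝ, E) ∞ (vectorCoord I X.proj) X :=
  (contMDiffAt_totalSpace.1 (contMDiffAt_id (x := X) (I := I.tangent) (n := ∞))).2

omit [CompleteSpace E] [I.Boundaryless] in
theorem contMDiffAt_covectorCoord (b : CotangentBundle I M) :
    ContMDiffAt (cotangentModel E I) 𝓘(ℝ, E →L[ℝ] ℝ) ∞ (covectorCoord I b.proj) b :=
  (contMDiffAt_cotangentBundle_iff.1
    (contMDiffAt_id (x := b) (I := cotangentModel E I) (n := ∞))).2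

/-- The base point of `alpha I X` is the image of `X` under the tangent map of the projection T*M →
M; in charts it keeps (q, q̇). -/
theorem contMDiff_alpha_proj :
    ContMDiff (cotangentModel E I).tangent I.tangent ∞
      (fun X : TangentBundle (cotangentModel E I) (CotangentBundle I M) => (alpha I X).proj) := by
  intro X₀
  have hp : ContMDiffAt (cotangentModel E I).tangent I ∞
      (fun X : TangentBundle (cotangentModel E I) (CotangentBundle I M) => X.proj.proj) X₀ :=
    (contMDiffAt_proj _).comp X₀ (contMDiffAt_proj _)
  have hs : ∀ᶠ X : TangentBundle (cotangentModel E I) (CotangentBundle I M) in 𝓝 X₀,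
      X.proj.proj ∈ (extChartAt I X₀.proj.proj).source :=
    hp.continuousAt (extChartAt_source_mem_nhds _)
  refine contMDiffAt_totalSpace.2 ⟨hp, ?_⟩
  have h := contDiff_fst.contMDiff.contMDiffAt.comp X₀ (contMDiffAt_vectorCoord X₀)
  exact h.congr_of_eventuallyEq (hs.mono fun X hX => (fst_vectorCoord hX).symm)

theorem contMDiff_alpha :
    ContMDiff (cotangentModel E I).tangent (cotangentModel (E × E) I.tangent) ∞
      (alpha I : _ → CotangentBundle I.tangent (TangentBundle I M)) := by
  intro X₀
  have hp : ContMDiffAt (cotangentModel E I).tangent I ∞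
      (fun X : TangentBundle (cotangentModel E I) (CotangentBundle I M) => X.proj.proj) X₀ :=
    (contMDiffAt_proj _).comp X₀ (contMDiffAt_proj _)
  have hs : ∀ᶠ X : TangentBundle (cotangentModel E I) (CotangentBundle I M) in 𝓝 X₀,
      X.proj.proj ∈ (extChartAt I X₀.proj.proj).source :=
    hp.continuousAt (extChartAt_source_mem_nhds _)
  refine contMDiffAt_cotangentBundle_iff.2 ⟨contMDiff_alpha_proj X₀, ?_⟩
  have h1 := contDiff_snd.contMDiff.contMDiffAt.comp X₀ (contMDiffAt_vectorCoord X₀)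
  have h2 : ContMDiffAt (cotangentModel E I).tangent 𝓘(ℝ, E →L[ℝ] ℝ) ∞
      (fun X : TangentBundle (cotangentModel E I) (CotangentBundle I M) =>
        covectorCoord I X₀.proj.proj X.proj) X₀ :=
    (contMDiffAt_covectorCoord X₀.proj).comp X₀ (contMDiffAt_proj _)
  have h := (h1.clm_comp (contMDiffAt_const (c := ContinuousLinearMap.fst ℝ E E))).add
    (h2.clm_comp (contMDiffAt_const (c := ContinuousLinearMap.snd ℝ E E)))
  refine h.congr_of_eventuallyEq (hs.mono fun X hX => ?_)
  exact (covectorCoord_alpha (ξ₀ := (alpha I X₀).proj) rfl hX).trans (by ext <;> simp)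

end Alpha

/-! ### The cotangent lift of a discretization map on a vector space. -/

section EuclideanLift

variable {E : Type*} [NormedAddCommGroup E] [NormedSpace ℝ E]

/-- The map `(a, b) ↦ b - a`. -/
def diffMap (E : Type*) [NormedAddCommGroup E] [NormedSpace ℝ E] : E × E →L[ℝ] E :=
  ContinuousLinearMap.snd ℝ E E - ContinuousLinearMap.fst ℝ E E

theorem diffMap_apply (z : E × E) : diffMap E z = z.2 - z.1 := rfl

section Linear

variable {L : E × E →L[ℝ] E × E} (hd : ∀ a, L (a, 0) = (a, a))
  (hv : ∀ v, diffMap E (L (0, v)) = v)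

include hd hv

theorem diffMap_comp_of_diag (z : E × E) : diffMap E (L z) = z.2 := by
  have : z = (z.1, 0) + (0, z.2) := by simp
  conv_lhs => rw [this, map_add, map_add, hd, hv, diffMap_apply]
  simp

theorem isInvertible_of_diag : L.IsInvertible := by
  have hL := diffMap_comp_of_diag hd hv
  have h0 : ∀ z : E × E, L z = (z.1, z.1) + L (0, z.2) := fun z => by
    rw [← hd, ← map_add]; simp
  -- Solving L(a, v) = z: the difference of components forces v = z₂ - z₁, and then the first
  -- component gives a = z₁ - L(0, v)₁.
  refine .of_inverse (g := (ContinuousLinearMap.fst ℝ E E - ContinuousLinearMap.fst ℝ E E ∘L L ∘L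
    ContinuousLinearMap.inr ℝ E E ∘L diffMap E).prod (diffMap E)) ?_ ?_
  · refine ContinuousLinearMap.ext fun z => ?_
    have h1 := hv (diffMap E z)
    rw [diffMap_apply] at h1
    simp only [ContinuousLinearMap.comp_apply, ContinuousLinearMap.prod_apply,
      _root_.sub_apply, ContinuousLinearMap.coe_fst', ContinuousLinearMap.inr_apply,
      ContinuousLinearMap.id_apply]
    rw [h0]
    refine Prod.ext (by simp) ?_
    have h2 := sub_eq_iff_eq_add.1 h1
    simp only [Prod.snd_add, h2]
    rw [diffMap_apply]; abel
  · refine ContinuousLinearMap.ext fun z => ?_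
    simp only [ContinuousLinearMap.comp_apply, ContinuousLinearMap.prod_apply,
      _root_.sub_apply, ContinuousLinearMap.coe_fst', ContinuousLinearMap.inr_apply,
      ContinuousLinearMap.id_apply, hL]
    exact Prod.ext (by rw [h0 z]; simp) rfl

theorem inverse_diag (a : E) : L.inverse (a, a) = (a, 0) := by
  rw [(isInvertible_of_diag hd hv).inverse_apply_eq, hd]

theorem snd_inverse (z : E × E) : (L.inverse z).2 = diffMap E z := by
  rw [← diffMap_comp_of_diag hd hv]
  exact congrArg _ (DFunLike.congr_fun (isInvertible_of_diag hd hv).self_comp_inverse z)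

end Linear

/-- The momentum components `(r, p) ∘ DF(x, v)⁻¹`, as a function of `w = (v, r)`. -/
def momentum (F : E × E → E × E) (x : E) (p : E →L[ℝ] ℝ) (w : E × (E →L[ℝ] ℝ)) :
    E × E →L[ℝ] ℝ :=
  ContinuousLinearMap.coprod w.2 p ∘L (fderiv ℝ F (x, w.1)).inverse

/-- The first component of the cotangent lift in coordinates, restricted to the fibre. -/
def fiberLift₁ (F : E × E → E × E) (x : E) (p : E →L[ℝ] ℝ) (w : E × (E →L[ℝ] ℝ)) :
    E × (E →L[ℝ] ℝ) :=
  ((F (x, w.1)).1, -(momentum F x p w ∘L ContinuousLinearMap.inl ℝ E E))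

/-- The second component of the cotangent lift in coordinates, restricted to the fibre. -/
def fiberLift₂ (F : E × E → E × E) (x : E) (p : E →L[ℝ] ℝ) (w : E × (E →L[ℝ] ℝ)) :
    E × (E →L[ℝ] ℝ) :=
  ((F (x, w.1)).2, momentum F x p w ∘L ContinuousLinearMap.inr ℝ E E)

variable {F : E × E → E × E} {x : E}

theorem fderiv_diag (hF : DifferentiableAt ℝ F (x, 0)) (hd : ∀ᶠ y in 𝓝 x, F (y, 0) = (y, y))
    (a : E) : fderiv ℝ F (x, 0) (a, 0) = (a, a) := by
  have h : HasFDerivAt (fun y => F (y, 0)) _ x :=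
    HasFDerivAt.comp x (g := F) (f := fun y => (y, (0 : E))) hF.hasFDerivAt
      ((hasFDerivAt_id x).prodMk (hasFDerivAt_const _ _))
  have h' : HasFDerivAt (fun y => F (y, 0)) _ x :=
    ((hasFDerivAt_id (𝕜 := ℝ) x).prodMk (hasFDerivAt_id (𝕜 := ℝ) x)).congr_of_eventuallyEq hd
  simpa using DFunLike.congr_fun (h.unique h') a

variable (hF : ContDiffAt ℝ 2 F (x, 0))
  (hd : ∀ᶠ y in 𝓝 x, F (y, 0) = (y, y))
  (hv : ∀ᶠ y in 𝓝 x, ∀ v, diffMap E (fderiv ℝ F (y, 0) (0, v)) = v)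

include hF hd hv

theorem isInvertible_fderiv_zero : (fderiv ℝ F (x, 0)).IsInvertible :=
  isInvertible_of_diag (fderiv_diag (hF.differentiableAt (by simp)) hd) hv.self_of_nhds

theorem momentum_zero (p : E →L[ℝ] ℝ) (z : E × E) : momentum F x p 0 z = p (diffMap E z) := by
  rw [← snd_inverse (fderiv_diag (hF.differentiableAt (by simp)) hd) hv.self_of_nhds]
  simp [momentum]

theorem contDiffAt_momentum [CompleteSpace E] (p : E →L[ℝ] ℝ) :
    ContDiffAt ℝ 1 (momentum F x p) 0 := by
  have hi := isInvertible_fderiv_zero hF hd hv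
  have h1 : ContDiffAt ℝ 1 (fun w : E × (E →L[ℝ] ℝ) => (fderiv ℝ F (x, w.1)).inverse) 0 :=
    ContDiffAt.comp (0 : E × (E →L[ℝ] ℝ)) (g := ContinuousLinearMap.inverse)
      (hi.contDiffAt_map_inverse)
      (ContDiffAt.comp (0 : E × (E →L[ℝ] ℝ)) (g := fderiv ℝ F)
        (hF.fderiv_right (m := 1) (by norm_num)) (by fun_prop))
  have h2 : ContDiffAt ℝ 1 (fun w : E × (E →L[ℝ] ℝ) => w.2 ∘L ContinuousLinearMap.fst ℝ E E +
      p ∘L ContinuousLinearMap.snd ℝ E E) 0 := by fun_prop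
  have h3 : (fun w : E × (E →L[ℝ] ℝ) => w.2 ∘L ContinuousLinearMap.fst ℝ E E +
      p ∘L ContinuousLinearMap.snd ℝ E E) = fun w => ContinuousLinearMap.coprod w.2 p := by
    ext <;> simp
  rw [h3] at h2
  exact h2.clm_comp h1

/-- The heart of the argument: on diagonal vectors the second-order terms of `F` drop out, leaving
only the fibre momentum. -/
theorem fderiv_momentum_diag [CompleteSpace E] (p : E →L[ℝ] ℝ) (w : E × (E →L[ℝ] ℝ)) (a : E) :
    fderiv ℝ (momentum F x p) 0 w (a, a) = w.2 a := by
  have hi := isInvertible_fderiv_zero hF hd hv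
  have hdiag := fderiv_diag (hF.differentiableAt (by simp)) hd
  have hDF := hF.fderiv_right (m := 1) (by norm_num)
  let K : E → E × E →L[ℝ] E × E := fun v => fderiv ℝ F (x, v)
  have hK : ContDiffAt ℝ 1 K 0 := ContDiffAt.comp (0 : E) (g := fderiv ℝ F) hDF (by fun_prop)
  have hKd : fderiv ℝ K 0 w.1 = fderiv ℝ (fderiv ℝ F) (x, 0) (0, w.1) := by
    have h : HasFDerivAt K _ 0 := HasFDerivAt.comp (0 : E) (g := fderiv ℝ F)
      (f := fun v => (x, v)) (hDF.differentiableAt (by simp)).hasFDerivAt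
      ((hasFDerivAt_const _ _).prodMk (hasFDerivAt_id _))
    rw [h.fderiv]; simp
  -- The condition on fibre derivatives holds all along the zero section, so it may be
  -- differentiated in the direction `a`; its right-hand side is constant.
  have hmixed : diffMap E (fderiv ℝ (fderiv ℝ F) (x, 0) (a, 0) (0, w.1)) = 0 := by
    have h : HasFDerivAt (fun y => fderiv ℝ F (y, 0)) _ x := HasFDerivAt.comp x (g := fderiv ℝ F)
      (f := fun y => (y, (0 : E))) (hDF.differentiableAt (by simp)).hasFDerivAt
      ((hasFDerivAt_id _).prodMk (hasFDerivAt_const _ _))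
    have h2 := (diffMap E).hasFDerivAt.comp x (h.clm_apply (hasFDerivAt_const (0, w.1) x))
    have h3 := (h2.congr_of_eventuallyEq (f₁ := fun _ => w.1)
      (hv.mono fun y hy => (hy w.1).symm)).unique (hasFDerivAt_const _ _)
    simpa using DFunLike.congr_fun h3 a
  have hsymm : fderiv ℝ (fderiv ℝ F) (x, 0) (0, w.1) (a, 0) =
      fderiv ℝ (fderiv ℝ F) (x, 0) (a, 0) (0, w.1) :=
    (hF.isSymmSndFDerivAt (by simp)).eq _ _
  have hinv : HasFDerivAt (fun v => (K v).inverse) (fderiv ℝ (fun v => (K v).inverse) 0) 0 :=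
    ((ContDiffAt.comp (0 : E) (g := ContinuousLinearMap.inverse)
      (hi.contDiffAt_map_inverse (n := 1)) hK).differentiableAt (by simp)).hasFDerivAt
  have hG : HasFDerivAt (fun v => (K v).inverse (a, a))
      ((fderiv ℝ (fun v => (K v).inverse) 0).flip (a, a)) 0 := by
    simpa using hinv.clm_apply (hasFDerivAt_const (a, a) 0)
  -- Writing (a, a) as K(0)(a, 0) brings it into the form needed to differentiate the inverse.
  have hval : fderiv ℝ (fun v => (K v).inverse) 0 w.1 (a, a) =
      - (K 0).inverse (fderiv ℝ K 0 w.1 (a, 0)) := by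
    rw [← fderiv_inverse_comp hK hi, ← hdiag]
  have hfst : HasFDerivAt (Prod.fst : E × (E →L[ℝ] ℝ) → E)
    (ContinuousLinearMap.fst ℝ E (E →L[ℝ] ℝ)) 0 := hasFDerivAt_fst
  have hG' := HasFDerivAt.comp (0 : E × (E →L[ℝ] ℝ)) (g := fun v => (K v).inverse (a, a))
    (f := Prod.fst) hG hfst
  have hm : HasFDerivAt (fun w => momentum F x p w (a, a)) _ (0 : E × (E →L[ℝ] ℝ)) :=
    (HasFDerivAt.clm_apply (c := fun w : E × (E →L[ℝ] ℝ) => w.2) hasFDerivAt_snd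
      ((ContinuousLinearMap.fst ℝ E E).hasFDerivAt.comp _ hG')).add
    (p.hasFDerivAt.comp _ ((ContinuousLinearMap.snd ℝ E E).hasFDerivAt.comp _ hG'))
  have hm' := ((contDiffAt_momentum hF hd hv p).differentiableAt (by simp)).hasFDerivAt.clm_apply
    (hasFDerivAt_const (a, a) 0)
  have h := DFunLike.congr_fun (hm'.unique hm) w
  have e1 : (K 0).inverse (a, a) = (a, 0) := inverse_diag hdiag hv.self_of_nhds a
  have e2 : ((K 0).inverse (fderiv ℝ (fderiv ℝ F) (x, 0) (0, w.1) (a, 0))).2 = 0 := by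
    rw [snd_inverse hdiag hv.self_of_nhds, hsymm, hmixed]
  simp [hval, hKd, e1, e2] at h
  exact h

theorem fderiv_fiberLift_sub [CompleteSpace E] (p : E →L[ℝ] ℝ) :
    fderiv ℝ (fiberLift₂ F x p) 0 - fderiv ℝ (fiberLift₁ F x p) 0 =
      ContinuousLinearMap.id ℝ (E × (E →L[ℝ] ℝ)) := by
  have hm := ((contDiffAt_momentum hF hd hv p).differentiableAt (by simp)).hasFDerivAt
  have hF' : HasFDerivAt (fun w : E × (E →L[ℝ] ℝ) => F (x, w.1)) _ 0 :=
    HasFDerivAt.comp (0 : E × (E →L[ℝ] ℝ)) (g := F) (f := fun w : E × (E →L[ℝ] ℝ) => (x, w.1))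
      (hF.differentiableAt (by simp)).hasFDerivAt
      ((hasFDerivAt_const x _).prodMk hasFDerivAt_fst)
  have h1 : HasFDerivAt (fiberLift₁ F x p) _ 0 :=
    ((ContinuousLinearMap.fst ℝ E E).hasFDerivAt.comp _ hF').prodMk
      (hm.clm_comp (hasFDerivAt_const (ContinuousLinearMap.inl ℝ E E) _)).neg
  have h2 : HasFDerivAt (fiberLift₂ F x p) _ 0 :=
    ((ContinuousLinearMap.snd ℝ E E).hasFDerivAt.comp _ hF').prodMk
      (hm.clm_comp (hasFDerivAt_const (ContinuousLinearMap.inr ℝ E E) _))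
  rw [h1.fderiv, h2.fderiv]
  refine ContinuousLinearMap.ext fun w => Prod.ext ?_ (ContinuousLinearMap.ext fun a => ?_)
  · simpa [diffMap_apply] using hv.self_of_nhds w.1
  · have := fderiv_momentum_diag hF hd hv p w a
    -- The minus sign in the first momentum turns the difference of momenta into a sum, the value on
    -- the diagonal.
    have h3 : ((a, a) : E × E) = (0, a) + (a, 0) := by simp
    rw [h3, map_add] at this
    simpa using this

end EuclideanLift

/-! ### Smoothness of the lift of a local diffeomorphism. -/

section Hat

variable {E : Type*} [NormedAddCommGroup E] [NormedSpace ℝ E]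
  {H : Type*} [TopologicalSpace H] {I : ModelWithCorners ℝ E H} [I.Boundaryless]
  {M : Type*} [TopologicalSpace M] [ChartedSpace H M] [IsManifold I ∞ M]
  {E' : Type*} [NormedAddCommGroup E'] [NormedSpace ℝ E']
  {H' : Type*} [TopologicalSpace H'] {I' : ModelWithCorners ℝ E' H'} [I'.Boundaryless]
  {M' : Type*} [TopologicalSpace M'] [ChartedSpace H' M'] [IsManifold I' ∞ M']

theorem isInvertible_fderiv_chart_iff {F : M → M'} {x₀ x : M} {y₀ : M'}
    (hF : MDifferentiableAt I I' F x) (hx : x ∈ (extChartAt I x₀).source)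
    (hy : F x ∈ (extChartAt I' y₀).source) :
    (fderiv ℝ (extChartAt I' y₀ ∘ F ∘ (extChartAt I x₀).symm)
      (extChartAt I x₀ x)).IsInvertible ↔ (mfderiv I I' F x).IsInvertible := by
  rw [(hasFDerivAt_chart_comp hF hx hy).fderiv]
  obtain ⟨e, he⟩ := isInvertible_tangentCoordChange (mem_extChartAt_source _) hy
  obtain ⟨e', he'⟩ := isInvertible_tangentCoordChange hx (mem_extChartAt_source (I := I) x)
  rw [← he, ← he']
  change _ ↔ (modelDeriv I I' F x).IsInvertible
  rw [ContinuousLinearMap.isInvertible_equiv_comp, ContinuousLinearMap.isInvertible_comp_equiv]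

omit [I.Boundaryless] [I'.Boundaryless] in
theorem eventually_mdifferentiableAt {F : M → M'} {x : M} (hF : ContMDiffAt I I' ∞ F x) :
    ∀ᶠ y in 𝓝 x, MDifferentiableAt I I' F y := by
  have h : ContMDiffAt I I' 1 F x := hF.of_le (WithTop.coe_le_coe.2 le_top)
  exact ((contMDiffAt_iff_contMDiffAt_nhds (by simp)).1 h).mono fun y hy =>
    hy.mdifferentiableAt (by simp)

omit [I'.Boundaryless] in
theorem contMDiffAt_fderiv_chart {F : M → M'} {x : M} (hF : ContMDiffAt I I' ∞ F x) :
    ContMDiffAt I 𝓘(ℝ, E →L[ℝ] E') ∞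
      (fun y => fderiv ℝ (extChartAt I' (F x) ∘ F ∘ (extChartAt I x).symm) (extChartAt I x y)) x :=
  ContMDiffAt.comp x (g := fderiv ℝ (extChartAt I' (F x) ∘ F ∘ (extChartAt I x).symm))
    ((contDiffAt_chart_comp hF (mem_extChartAt_source x) (mem_extChartAt_source _)).fderiv_right
      (m := ∞) (by simp)).contMDiffAt contMDiffAt_extChartAt

/-- In fixed charts the derivative is a continuous family of operators, and invertible operators
form an open set. -/
theorem isOpen_setOf_isInvertible_mfderiv [CompleteSpace E] {F : M → M'} {U : Set M}
    (hU : IsOpen U) (hF : ContMDiffOn I I' ∞ F U) :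
    IsOpen {x | x ∈ U ∧ (mfderiv I I' F x).IsInvertible} := by
  rw [isOpen_iff_mem_nhds]
  rintro x ⟨hx, hi⟩
  have hFx := hF.contMDiffAt (hU.mem_nhds hx)
  have hs : ∀ᶠ y in 𝓝 x, F y ∈ (extChartAt I' (F x)).source :=
    hFx.continuousAt (extChartAt_source_mem_nhds _)
  have hd := eventually_mdifferentiableAt hFx
  have hi' := eventually_isInvertible (contMDiffAt_fderiv_chart hFx).continuousAt
    ((isInvertible_fderiv_chart_iff hd.self_of_nhds (mem_extChartAt_source _)
      (mem_extChartAt_source _)).2 hi)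
  filter_upwards [hU.mem_nhds hx, hs, hd, hi', extChartAt_source_mem_nhds (I := I) x]
    with y h1 h2 h3 h4 h5
  exact ⟨h1, (isInvertible_fderiv_chart_iff h3 h5 h2).1 h4⟩

theorem contMDiffAt_hat [CompleteSpace E] {F : M → M'} {b : CotangentBundle I M}
    (hF : ContMDiffAt I I' ∞ F b.proj) (hi : (mfderiv I I' F b.proj).IsInvertible) :
    ContMDiffAt (cotangentModel E I) (cotangentModel E' I') ∞ (hat I I' F) b := by
  have hp : ContMDiffAt (cotangentModel E I) I ∞ (fun c : CotangentBundle I M => c.proj) b :=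
    contMDiffAt_proj _
  have hFp : ContMDiffAt (cotangentModel E I) I' ∞ (fun c : CotangentBundle I M => F c.proj) b :=
    hF.comp b hp
  refine contMDiffAt_cotangentBundle_iff.2 ⟨hFp, ?_⟩
  have hd := eventually_mdifferentiableAt hF
  have hinv := (isInvertible_fderiv_chart_iff hd.self_of_nhds (mem_extChartAt_source _)
      (mem_extChartAt_source _)).2 hi
  have h1 := (hinv.contDiffAt_map_inverse (n := ∞)).contMDiffAt.comp b
    ((contMDiffAt_fderiv_chart hF).comp b hp)
  refine ((contMDiffAt_covectorCoord b).clm_comp h1).congr_of_eventuallyEq ?_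
  filter_upwards [hp.continuousAt (extChartAt_source_mem_nhds (I := I) b.proj),
    hFp.continuousAt (extChartAt_source_mem_nhds (I := I') (F b.proj)),
    hp.continuousAt hd] with c h2 h3 h4
  exact covectorCoord_hat h4 h2 h3

end Hat

/-! ### The map Φ⁻¹ in charts. -/

section PhiCoord

variable {E : Type*} [NormedAddCommGroup E] [NormedSpace ℝ E]
  {H : Type*} [TopologicalSpace H] {I : ModelWithCorners ℝ E H} [I.Boundaryless]
  {M : Type*} [TopologicalSpace M] [ChartedSpace H M] [IsManifold I ∞ M]

/-- Coordinate changes on a product are block diagonal, so restricting a covector to one factor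
commutes with them. -/
theorem tangentCoordChange_prod {x y z : M × M}
    (hx : z ∈ (extChartAt (I.prod I) x).source) (hy : z ∈ (extChartAt (I.prod I) y).source) :
    tangentCoordChange (I.prod I) x y z =
      (tangentCoordChange I x.1 y.1 z.1).prodMap (tangentCoordChange I x.2 y.2 z.2) := by
  have key : ∀ {x y z : M}, z ∈ (extChartAt I x).source → z ∈ (extChartAt I y).source →
      HasFDerivAt (extChartAt I y ∘ (extChartAt I x).symm) (tangentCoordChange I x y z)
        (extChartAt I x z) := fun {x y z} hx hy => by
    have := hasFDerivWithinAt_tangentCoordChange (I := I) ⟨hx, hy⟩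
    rwa [I.range_eq_univ, hasFDerivWithinAt_univ] at this
  rw [extChartAt_prod] at hx hy
  rw [tangentCoordChange_eq_fderiv, extChartAt_prod, extChartAt_prod]
  exact (HasFDerivAt.prodMap (p := (extChartAt I x.1 z.1, extChartAt I x.2 z.2))
    (key hx.1 hy.1) (key hx.2 hy.2)).fderiv

theorem covectorCoord_Phi_symm_fst {y : M × M} {b : CotangentBundle (I.prod I) (M × M)}
    (hb : b.proj ∈ (extChartAt (I.prod I) y).source) :
    covectorCoord I y.1 ((Phi I).symm b).1 =
      -(covectorCoord (I.prod I) y b ∘L ContinuousLinearMap.inl ℝ E E) := by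
  refine ContinuousLinearMap.ext fun v => ?_
  rw [covectorCoord, covectorCoord, tangentCoordChange_prod hb (mem_extChartAt_source _)]
  change -(b.snd : E × E →L[ℝ] ℝ) (tangentCoordChange I y.1 b.proj.1 b.proj.1 v, 0) =
    -(b.snd : E × E →L[ℝ] ℝ) (tangentCoordChange I y.1 b.proj.1 b.proj.1 v,
      tangentCoordChange I y.2 b.proj.2 b.proj.2 0)
  rw [map_zero]

theorem covectorCoord_Phi_symm_snd {y : M × M} {b : CotangentBundle (I.prod I) (M × M)}
    (hb : b.proj ∈ (extChartAt (I.prod I) y).source) :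
    covectorCoord I y.2 ((Phi I).symm b).2 =
      covectorCoord (I.prod I) y b ∘L ContinuousLinearMap.inr ℝ E E := by
  refine ContinuousLinearMap.ext fun v => ?_
  rw [covectorCoord, covectorCoord, tangentCoordChange_prod hb (mem_extChartAt_source _)]
  change (b.snd : E × E →L[ℝ] ℝ) (0, tangentCoordChange I y.2 b.proj.2 b.proj.2 v) =
    (b.snd : E × E →L[ℝ] ℝ) (tangentCoordChange I y.1 b.proj.1 b.proj.1 0,
      tangentCoordChange I y.2 b.proj.2 b.proj.2 v)
  rw [map_zero]

theorem contMDiff_Phi_symm :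
    ContMDiff (cotangentModel (E × E) (I.prod I)) ((cotangentModel E I).prod (cotangentModel E I))
      ∞ ((Phi I).symm : CotangentBundle (I.prod I) (M × M) → _) := by
  intro b
  have hp : ContMDiffAt (cotangentModel (E × E) (I.prod I)) (I.prod I) ∞
      (fun c : CotangentBundle (I.prod I) (M × M) => c.proj) b := contMDiffAt_proj _
  have hs : ∀ᶠ c : CotangentBundle (I.prod I) (M × M) in 𝓝 b,
      c.proj ∈ (extChartAt (I.prod I) b.proj).source :=
    hp.continuousAt (extChartAt_source_mem_nhds _)
  have hc := contMDiffAt_covectorCoord b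
  refine ContMDiffAt.prodMk (contMDiffAt_cotangentBundle_iff.2 ⟨hp.fst, ?_⟩)
    (contMDiffAt_cotangentBundle_iff.2 ⟨hp.snd, ?_⟩)
  · refine (hc.clm_comp (contMDiffAt_const (c := -ContinuousLinearMap.inl ℝ E E))
      ).congr_of_eventuallyEq (hs.mono fun c hc => ?_)
    refine (covectorCoord_Phi_symm_fst hc).trans ?_
    ext; simp
  · exact (hc.clm_comp (contMDiffAt_const (c := ContinuousLinearMap.inr ℝ E E))
      ).congr_of_eventuallyEq (hs.mono fun c hc => covectorCoord_Phi_symm_snd hc)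

end PhiCoord

/-! ### Derivatives along the fibres of the tangent bundle. -/

section Fiber

variable {E : Type*} [NormedAddCommGroup E] [NormedSpace ℝ E]
  {H : Type*} [TopologicalSpace H] {I : ModelWithCorners ℝ E H}
  {M : Type*} [TopologicalSpace M] [ChartedSpace H M] [IsManifold I 1 M]

theorem contMDiff_fiber_inclusion (x : M) {n : WithTop ℕ∞} :
    ContMDiff 𝓘(ℝ, E) I.tangent n (fun u : E => (⟨x, u⟩ : TangentBundle I M)) := by
  intro u
  refine contMDiffAt_totalSpace.2 ⟨contMDiffAt_const, ?_⟩
  refine contMDiffAt_id.congr_of_eventuallyEq (.of_forall fun v => ?_)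
  exact tangentCoordChange_self (mem_extChartAt_source x)

theorem hasFDerivAt_extChartAt_comp [I.Boundaryless] {V : Type*} [NormedAddCommGroup V]
    [NormedSpace ℝ V] {g : V → M} {x₀ x : M} {u : V} (hg : MDifferentiableAt 𝓘(ℝ, V) I g u)
    (hu : g u = x) (hx : x ∈ (extChartAt I x₀).source) :
    HasFDerivAt (fun v => extChartAt I x₀ (g v))
      (tangentCoordChange I x x₀ x ∘L modelDeriv 𝓘(ℝ, V) I g u) u := by
  subst hu
  have h := hasFDerivAt_chart_comp (x₀ := u) (y₀ := x₀) hg (mem_extChartAt_source _) hx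
  rw [tangentCoordChange_self_eq_id (mem_extChartAt_source _)] at h
  exact h

/-- The derivative along the fibre in the chart at `x₀`. -/
theorem hasFDerivAt_fiber [I.Boundaryless] {f : TangentBundle I M → M} {x₀ x : M}
    (hf : MDifferentiableAt I.tangent I f ⟨x, 0⟩) (h0 : f ⟨x, 0⟩ = x)
    (hx : x ∈ (extChartAt I x₀).source) :
    HasFDerivAt (fun u : E => extChartAt I x₀ (f ⟨x, u⟩))
      (tangentCoordChange I x x₀ x ∘L fiberDeriv I f x) 0 := by
  have hg : MDifferentiableAt 𝓘(ℝ, E) I (fun u : E => f ⟨x, u⟩) 0 :=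
    hf.comp (0 : E) ((contMDiff_fiber_inclusion x (n := 1)).mdifferentiableAt (by simp))
  exact hasFDerivAt_extChartAt_comp hg h0 hx

end Fiber

/-! ### Transfer of the vector space computation to the manifold. -/

section Lift

variable {E : Type*} [NormedAddCommGroup E] [NormedSpace ℝ E]
  {H : Type*} [TopologicalSpace H] {I : ModelWithCorners ℝ E H} [I.Boundaryless]
  {M : Type*} [TopologicalSpace M] [ChartedSpace H M] [IsManifold I ∞ M]
  {U : Set (TangentBundle I M)} {R : TangentBundle I M → M × M}

variable (I R) in
/-- The expression of `R : TM → M × M` in the charts induced by the chart of `M` at `q`. -/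
def chartMap (q : M) : E × E → E × E :=
  extChartAt (I.prod I) (q, q) ∘ R ∘ (extChartAt I.tangent (⟨q, 0⟩ : TangentBundle I M)).symm

omit [I.Boundaryless] in
theorem IsDiscretizationMap.contMDiffAt (hR : IsDiscretizationMap I U R)
    {ξ : TangentBundle I M} (hξ : ξ ∈ U) : ContMDiffAt I.tangent (I.prod I) ∞ R ξ :=
  hR.contMDiffOn.contMDiffAt (hR.isOpen_domain.mem_nhds hξ)

omit [I.Boundaryless] in
theorem IsDiscretizationMap.mdifferentiableAt (hR : IsDiscretizationMap I U R)
    {ξ : TangentBundle I M} (hξ : ξ ∈ U) : MDifferentiableAt I.tangent (I.prod I) R ξ :=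
  (hR.contMDiffAt hξ).mdifferentiableAt (by simp)

omit [I.Boundaryless] in
theorem extChartAt_symm_tangent {q y : M} (hy : y ∈ (extChartAt I q).source) (v : E) :
    (extChartAt I.tangent (⟨q, 0⟩ : TangentBundle I M)).symm (extChartAt I q y, v) =
      ⟨y, tangentCoordChange I q y y v⟩ := by
  have h : extChartAt I.tangent (⟨q, 0⟩ : TangentBundle I M)
      ⟨y, tangentCoordChange I q y y v⟩ = (extChartAt I q y, v) := by
    rw [extChartAt_tangentBundle_apply]
    exact Prod.ext rfl (DFunLike.congr_fun
      (tangentCoordChange_comp_symm (mem_extChartAt_source (I := I) y) hy) v)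
  rw [← h]
  exact (extChartAt I.tangent (⟨q, 0⟩ : TangentBundle I M)).left_inv
    (mem_extChartAt_tangentBundle_source.2 hy)

omit [I.Boundaryless] in
theorem chartMap_apply {q y : M} (hy : y ∈ (extChartAt I q).source) (v : E) :
    chartMap I R q (extChartAt I q y, v) =
      (extChartAt I q (R ⟨y, tangentCoordChange I q y y v⟩).1,
        extChartAt I q (R ⟨y, tangentCoordChange I q y y v⟩).2) := by
  rw [chartMap, Function.comp_apply, Function.comp_apply, extChartAt_symm_tangent hy,
    extChartAt_prod]
  rfl

omit [I.Boundaryless] in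
theorem extChartAt_tangent_zero (q : M) (v : E) :
    extChartAt I.tangent (⟨q, 0⟩ : TangentBundle I M) ⟨q, v⟩ = (extChartAt I q q, v) := by
  rw [extChartAt_tangentBundle_apply]
  exact Prod.ext rfl (tangentCoordChange_self (mem_extChartAt_source q))

omit [IsManifold I ∞ M] in
theorem eventually_extChartAt (q : M) (P : E → Prop)
    (hP : ∀ y ∈ (extChartAt I q).source, P (extChartAt I q y)) :
    ∀ᶠ e in 𝓝 (extChartAt I q q), P e := by
  filter_upwards [extChartAt_target_mem_nhds (I := I) q] with e he
  rw [← (extChartAt I q).right_inv he]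
  exact hP _ ((extChartAt I q).map_target he)

section

variable (hR : IsDiscretizationMap I U R) (q : M)

include hR

theorem contDiffAt_chartMap : ContDiffAt ℝ 2 (chartMap I R q) (extChartAt I q q, 0) := by
  have h := contDiffAt_chart_comp (n := ∞) (x₀ := (⟨q, 0⟩ : TangentBundle I M)) (y₀ := (q, q))
    (hR.contMDiffAt (hR.zero_mem q)) (mem_extChartAt_source _)
    (by rw [hR.map_zero]; exact mem_extChartAt_source _)
  have hz : extChartAt I.tangent (⟨q, 0⟩ : TangentBundle I M) ⟨q, 0⟩ = (extChartAt I q q, 0) :=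
    extChartAt_tangent_zero q 0
  rw [hz] at h
  exact h.of_le (WithTop.coe_le_coe.2 le_top)

theorem chartMap_diag : ∀ᶠ e in 𝓝 (extChartAt I q q), chartMap I R q (e, 0) = (e, e) := by
  refine eventually_extChartAt q _ fun y hy => ?_
  rw [chartMap_apply hy, map_zero]
  exact congrArg (fun z : M × M => (extChartAt I q z.1, extChartAt I q z.2)) (hR.map_zero y)

/-- The condition is needed at all nearby points, since it is later differentiated along the zero
section; hence a fixed chart at `q` and a varying `y`. -/
theorem diffMap_fderiv_chartMap : ∀ᶠ e in 𝓝 (extChartAt I q q),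
    ∀ v, diffMap E (fderiv ℝ (chartMap I R q) (e, 0) (0, v)) = v := by
  refine eventually_extChartAt q _ fun y hy v => ?_
  have hyz : (⟨y, 0⟩ : TangentBundle I M) ∈
      (extChartAt I.tangent (⟨q, 0⟩ : TangentBundle I M)).source :=
    mem_extChartAt_tangentBundle_source.2 hy
  have hRy := hR.mdifferentiableAt (hR.zero_mem y)
  have hz : extChartAt I.tangent (⟨q, 0⟩ : TangentBundle I M) ⟨y, 0⟩ = (extChartAt I q y, 0) := by
    rw [extChartAt_tangentBundle_apply]; exact Prod.ext rfl (map_zero _)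
  have hF : DifferentiableAt ℝ (chartMap I R q) (extChartAt I q y, 0) := by
    have h := (hasFDerivAt_chart_comp (x₀ := (⟨q, 0⟩ : TangentBundle I M)) (y₀ := (q, q)) hRy hyz
      (by rw [hR.map_zero, extChartAt_prod]; exact ⟨hy, hy⟩)).differentiableAt
    rwa [hz] at h
  have hcomp : HasFDerivAt (fun v => chartMap I R q (extChartAt I q y, v)) _ 0 :=
    HasFDerivAt.comp (0 : E) (g := chartMap I R q) (f := fun v => (extChartAt I q y, v))
      hF.hasFDerivAt ((hasFDerivAt_const _ _).prodMk (hasFDerivAt_id _))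
  have hdiff := (diffMap E).hasFDerivAt.comp (0 : E) hcomp
  have h1 := hasFDerivAt_fiber (x₀ := q) (f := fun ξ => (R ξ).1) hRy.fst
    (by simp [hR.map_zero]) hy
  have h2 := hasFDerivAt_fiber (x₀ := q) (f := fun ξ => (R ξ).2) hRy.snd
    (by simp [hR.map_zero]) hy
  have h12 := h2.sub h1
  rw [← ContinuousLinearMap.comp_sub, hR.fiberDeriv_sub, ContinuousLinearMap.comp_id] at h12
  -- A fibre vector at `y` written in the chart at `q` first passes to the chart at `y`; this change
  -- undoes the one on the values.
  have h12' := HasFDerivAt.comp (0 : E) (f := tangentCoordChange I q y y)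
    (by rw [map_zero]; exact h12) (tangentCoordChange I q y y).hasFDerivAt
  rw [tangentCoordChange_comp_symm (mem_extChartAt_source y) hy] at h12'
  have heq := hdiff.unique (h12'.congr_of_eventuallyEq (.of_forall fun v => ?_))
  · simpa using DFunLike.congr_fun heq v
  · simp only [Function.comp_apply, chartMap_apply hy, diffMap_apply]
    rfl

theorem isInvertible_mfderiv_zero :
    (mfderiv I.tangent (I.prod I) R (⟨q, 0⟩ : TangentBundle I M)).IsInvertible := by
  rw [← isInvertible_fderiv_chart_iff (x₀ := (⟨q, 0⟩ : TangentBundle I M)) (y₀ := (q, q))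
    (hR.mdifferentiableAt (hR.zero_mem q)) (mem_extChartAt_source _)
    (by rw [hR.map_zero]; exact mem_extChartAt_source _)]
  have hz : extChartAt I.tangent (⟨q, 0⟩ : TangentBundle I M) ⟨q, 0⟩ = (extChartAt I q q, 0) :=
    extChartAt_tangent_zero q 0
  rw [hz]
  exact isInvertible_fderiv_zero (contDiffAt_chartMap hR q) (chartMap_diag hR q)
    (diffMap_fderiv_chartMap hR q)

end

variable [CompleteSpace E]

theorem IsDiscretizationMap.isOpen_cotangentLiftDomain (hR : IsDiscretizationMap I U R) :
    IsOpen (cotangentLiftDomain I U R) :=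
  (isOpen_setOf_isInvertible_mfderiv hR.isOpen_domain hR.contMDiffOn).preimage
    contMDiff_alpha_proj.continuous

theorem IsDiscretizationMap.contMDiffOn_cotangentLift (hR : IsDiscretizationMap I U R) :
    ContMDiffOn (cotangentModel E I).tangent ((cotangentModel E I).prod (cotangentModel E I)) ∞
      (cotangentLift I R) (cotangentLiftDomain I U R) := by
  rintro X ⟨hX, hi⟩
  exact ((contMDiff_Phi_symm _).comp X ((contMDiffAt_hat (hR.contMDiffAt hX) hi).comp X
    (contMDiff_alpha X))).contMDiffWithinAt

omit [CompleteSpace E] in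
theorem zero_mem_cotangentLiftDomain (hR : IsDiscretizationMap I U R) (a : CotangentBundle I M) :
    (⟨a, 0⟩ : TangentBundle (cotangentModel E I) (CotangentBundle I M)) ∈
      cotangentLiftDomain I U R :=
  ⟨hR.zero_mem a.proj, isInvertible_mfderiv_zero hR a.proj⟩

/-- The covector `R̂ (α X)` for `X = (v, r)` tangent to `T*M` at `a`, in the chart at `a`. -/
theorem covectorCoord_hat_alpha (hR : IsDiscretizationMap I U R) {a : CotangentBundle I M}
    {w : E × (E →L[ℝ] ℝ)} (hw : (⟨a.proj, w.1⟩ : TangentBundle I M) ∈ U)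
    (hs : R ⟨a.proj, w.1⟩ ∈ (extChartAt (I.prod I) (a.proj, a.proj)).source) :
    covectorCoord (I.prod I) (a.proj, a.proj) (hat I.tangent (I.prod I) R
      (alpha I (⟨a, w⟩ : TangentBundle (cotangentModel E I) (CotangentBundle I M)))) =
      momentum (chartMap I R a.proj) (extChartAt I a.proj a.proj) a.snd w := by
  have hα := covectorCoord_alpha (a₀ := a) (ξ₀ := (⟨a.proj, 0⟩ : TangentBundle I M)) rfl
    (X := (⟨a, w⟩ : TangentBundle (cotangentModel E I) (CotangentBundle I M)))
    (mem_extChartAt_source a.proj)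
  have hvec : vectorCoord (cotangentModel E I) a
      (⟨a, w⟩ : TangentBundle (cotangentModel E I) (CotangentBundle I M)) = w :=
    tangentCoordChange_self (mem_extChartAt_source a)
  rw [covectorCoord_hat (x₀ := (⟨a.proj, 0⟩ : TangentBundle I M)) (hR.mdifferentiableAt hw)
    (mem_extChartAt_tangentBundle_source.2 (mem_extChartAt_source a.proj)) hs, hα, hvec]
  have hz : extChartAt I.tangent (⟨a.proj, 0⟩ : TangentBundle I M)
      (alpha I (⟨a, w⟩ : TangentBundle (cotangentModel E I) (CotangentBundle I M))).proj =
      (extChartAt I a.proj a.proj, w.1) := extChartAt_tangent_zero a.proj w.1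
  rw [hz, covectorCoord_self]
  rfl

omit [CompleteSpace E] [I.Boundaryless] in
-- Comparing covectors through coordinates in one chart avoids transporting along the equality of
-- base points.
theorem cotangentBundle_ext {a b : CotangentBundle I M} (h : b.proj = a.proj)
    (h' : covectorCoord I a.proj b = a.snd) : b = a := by
  obtain ⟨x, p⟩ := a
  obtain ⟨y, r⟩ := b
  obtain rfl : y = x := h
  exact congrArg (TotalSpace.mk y)
    ((covectorCoord_self (⟨y, r⟩ : CotangentBundle I M)).symm.trans h')

theorem cotangentLift_zero (hR : IsDiscretizationMap I U R) (a : CotangentBundle I M) :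
    cotangentLift I R ⟨a, 0⟩ = (a, a) := by
  have hs : R ⟨a.proj, 0⟩ ∈ (extChartAt (I.prod I) (a.proj, a.proj)).source := by
    rw [hR.map_zero]; exact mem_extChartAt_source _
  have hc := covectorCoord_hat_alpha hR (a := a) (w := 0) (hR.zero_mem a.proj) hs
  have hm := momentum_zero (contDiffAt_chartMap hR a.proj) (chartMap_diag hR a.proj)
    (diffMap_fderiv_chartMap hR a.proj) a.snd
  refine Prod.ext (cotangentBundle_ext ?_ ?_) (cotangentBundle_ext ?_ ?_)
  · exact congrArg Prod.fst (hR.map_zero a.proj)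
  · refine (covectorCoord_Phi_symm_fst (y := (a.proj, a.proj)) hs).trans ?_
    refine (congrArg (fun L : E × E →L[ℝ] ℝ => -(L ∘L ContinuousLinearMap.inl ℝ E E)) hc).trans ?_
    refine ContinuousLinearMap.ext fun v => ?_
    change -(momentum _ _ _ _ (v, 0)) = _
    rw [hm, diffMap_apply]
    change -((a.snd : E →L[ℝ] ℝ) ((0 : E) - (v : E))) = (a.snd : E →L[ℝ] ℝ) v
    rw [zero_sub]
    exact (congrArg Neg.neg (map_neg (a.snd : E →L[ℝ] ℝ) v)).trans (neg_neg _)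
  · exact congrArg Prod.snd (hR.map_zero a.proj)
  · refine (covectorCoord_Phi_symm_snd (y := (a.proj, a.proj)) hs).trans ?_
    refine (congrArg (fun L : E × E →L[ℝ] ℝ => L ∘L ContinuousLinearMap.inr ℝ E E) hc).trans ?_
    refine ContinuousLinearMap.ext fun v => ?_
    change momentum _ _ _ _ (0, v) = _
    rw [hm, diffMap_apply]
    change (a.snd : E →L[ℝ] ℝ) ((v : E) - (0 : E)) = (a.snd : E →L[ℝ] ℝ) v
    rw [sub_zero]

theorem eventually_extChartAt_cotangentLift (hR : IsDiscretizationMap I U R)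
    (a : CotangentBundle I M) : ∀ᶠ w : E × (E →L[ℝ] ℝ) in 𝓝 0,
      extChartAt (cotangentModel E I) a (cotangentLift I R ⟨a, w⟩).1 =
        fiberLift₁ (chartMap I R a.proj) (extChartAt I a.proj a.proj) a.snd w ∧
      extChartAt (cotangentModel E I) a (cotangentLift I R ⟨a, w⟩).2 =
        fiberLift₂ (chartMap I R a.proj) (extChartAt I a.proj a.proj) a.snd w := by
  have hc : Continuous fun w : E × (E →L[ℝ] ℝ) => (⟨a.proj, w.1⟩ : TangentBundle I M) :=
    (contMDiff_fiber_inclusion a.proj (n := 1)).continuous.comp continuous_fst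
  have hU : ∀ᶠ w : E × (E →L[ℝ] ℝ) in 𝓝 0, (⟨a.proj, w.1⟩ : TangentBundle I M) ∈ U :=
    hc.continuousAt (hR.isOpen_domain.mem_nhds (hR.zero_mem a.proj))
  have hs : ∀ᶠ w : E × (E →L[ℝ] ℝ) in 𝓝 0,
      R ⟨a.proj, w.1⟩ ∈ (extChartAt (I.prod I) (a.proj, a.proj)).source := by
    refine ContinuousAt.comp (g := R) (f := fun w : E × (E →L[ℝ] ℝ) =>
      (⟨a.proj, w.1⟩ : TangentBundle I M)) (x := 0)
      (hR.contMDiffAt (hR.zero_mem a.proj)).continuousAt hc.continuousAt ?_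
    have h0 : R ⟨a.proj, (0 : E × (E →L[ℝ] ℝ)).1⟩ = (a.proj, a.proj) := hR.map_zero a.proj
    rw [Function.comp_apply, h0]
    exact extChartAt_source_mem_nhds _
  filter_upwards [hU, hs] with w hw hs
  have hc := covectorCoord_hat_alpha hR hw hs
  have hs' := hs
  rw [extChartAt_prod] at hs'
  have hF : chartMap I R a.proj (extChartAt I a.proj a.proj, w.1) =
      (extChartAt I a.proj (R ⟨a.proj, w.1⟩).1, extChartAt I a.proj (R ⟨a.proj, w.1⟩).2) := by
    rw [chartMap_apply (mem_extChartAt_source _),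
      tangentCoordChange_self (mem_extChartAt_source _)]
  constructor
  · refine (extChartAt_cotangentBundle_apply (b := (cotangentLift I R ⟨a, w⟩).1) hs'.1).trans
      (Prod.ext (congrArg Prod.fst hF).symm ?_)
    exact (covectorCoord_Phi_symm_fst (y := (a.proj, a.proj)) hs).trans
      (congrArg (fun L : E × E →L[ℝ] ℝ => -(L ∘L ContinuousLinearMap.inl ℝ E E)) hc)
  · refine (extChartAt_cotangentBundle_apply (b := (cotangentLift I R ⟨a, w⟩).2) hs'.2).trans
      (Prod.ext (congrArg Prod.snd hF).symm ?_)
    exact (covectorCoord_Phi_symm_snd (y := (a.proj, a.proj)) hs).trans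
      (congrArg (fun L : E × E →L[ℝ] ℝ => L ∘L ContinuousLinearMap.inr ℝ E E) hc)

theorem fiberDeriv_cotangentLift_sub (hR : IsDiscretizationMap I U R) (a : CotangentBundle I M) :
    fiberDeriv (cotangentModel E I) (fun X => (cotangentLift I R X).2) a -
      fiberDeriv (cotangentModel E I) (fun X => (cotangentLift I R X).1) a =
      ContinuousLinearMap.id ℝ (E × (E →L[ℝ] ℝ)) := by
  have hsm : MDifferentiableAt (cotangentModel E I).tangent
      ((cotangentModel E I).prod (cotangentModel E I)) (cotangentLift I R) ⟨a, 0⟩ :=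
    (hR.contMDiffOn_cotangentLift.contMDiffAt (hR.isOpen_cotangentLiftDomain.mem_nhds
      (zero_mem_cotangentLiftDomain hR a))).mdifferentiableAt (by simp)
  have h0 := cotangentLift_zero hR a
  have h1 := hasFDerivAt_fiber (x₀ := a) hsm.fst (congrArg Prod.fst h0) (mem_extChartAt_source a)
  have h2 := hasFDerivAt_fiber (x₀ := a) hsm.snd (congrArg Prod.snd h0) (mem_extChartAt_source a)
  rw [tangentCoordChange_self_eq_id (mem_extChartAt_source a), ContinuousLinearMap.id_comp]
    at h1 h2
  have he := eventually_extChartAt_cotangentLift hR a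
  have e1 := (h1.congr_of_eventuallyEq (he.mono fun w hw => hw.1.symm)).fderiv
  have e2 := (h2.congr_of_eventuallyEq (he.mono fun w hw => hw.2.symm)).fderiv
  -- In the chart at `a` the fibre derivatives are those of `fiberLift₁` and `fiberLift₂`, as both
  -- components of the lift send the zero vector to `a` itself.
  rw [← e1, ← e2]
  exact fderiv_fiberLift_sub (contDiffAt_chartMap hR a.proj) (chartMap_diag hR a.proj)
    (diffMap_fderiv_chartMap hR a.proj) a.snd

end Lift

end DiscretizationMap

end

theorem mainTheorem2 {E : Type*} [NormedAddCommGroup E] [NormedSpace ℝ E] [FiniteDimensional ℝ E]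
    {H : Type*} [TopologicalSpace H] (I : ModelWithCorners ℝ E H) [I.Boundaryless]
    {Q : Type*} [TopologicalSpace Q] [ChartedSpace H Q] [IsManifold I ∞ Q]
    (U : Set (TangentBundle I Q)) (R : TangentBundle I Q → Q × Q)
    (hR : DiscretizationMap.IsDiscretizationMap I U R) :
    DiscretizationMap.IsDiscretizationMap (DiscretizationMap.cotangentModel E I)
      (DiscretizationMap.cotangentLiftDomain I U R) (DiscretizationMap.cotangentLift I R) := by
  have : CompleteSpace E := FiniteDimensional.complete ℝ E
  exact
    { isOpen_domain := hR.isOpen_cotangentLiftDomain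
      zero_mem := DiscretizationMap.zero_mem_cotangentLiftDomain hR
      contMDiffOn := hR.contMDiffOn_cotangentLift
      map_zero := DiscretizationMap.cotangentLift_zero hR
      fiberDeriv_sub := DiscretizationMap.fiberDeriv_cotangentLift_sub hR }
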